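/- Let $\mathbb{A}$ be a semi-abelian category, that is, a pointed, Barr-exact, (Bourn) protomodular category with binary coproducts. Let $$0\to M\xrightarrow{\;k\;}X\underset{s}{\overset{p}{\rightleftarrows}}L\to 0$$ be a split extension in $\mathbb{A}$, i.e. $p\circ s=1_L$ and $k$ is a kernel of $p$. A point over $L$ is a split epimorphism with codomain $L$ together with a chosen splitting; the point $(p,s)$ is called trivial if it is isomorphic, as a point over $L$ and compatibly with the inclusions of the kernel $M$ of $p$, to the point $M\times L\rightleftarrows L$ given by the second projection and $\langle 0,1_L\rangle$. The full subcategory of trivial points over $L$ is reflective in the category of points over $L$: the reflection of $(p,s)$ is $C_s\times L\rightleftarrows L$, where $c_s\colon X\to C_s$ is the cokernel of $s$ (the object of coinvariants), with unit $\eta=\langle c_s,p\rangle\colon X\to C_s\times L$. The coinvariants commutator $\llbracket L,M\rrbracket$ is the kernel (in $\mathbb{A}$) of the split epimorphism underlying the kernel of $\eta$ in the category of points over $L$; the inclusion of the kernel of $\eta$ into $(p,s)$ makes it a subobject of $X$. The Higgins commutator $[L,M]\leq X$ is the image of the composite of the kernel $L\diamond M\to L+M$ of the canonical morphism $L+M\to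 L\times M$ with the morphism $\binom{s}{k}\colon L+M\to X$. Then $\llbracket L,M\rrbracket=[L,M]$ as subobjects of $X$. In particular, the inclusion of $[L,M]$ into $X$ factors through $k$, and $C_s\cong M/[L,M]$, where $M/[L,M]$ is the cokernel of the induced inclusion $[L,M]\to M$; this isomorphism is compatible with the canonical morphisms $c_s\circ k\colon M\to C_s$ and $M\to M/[L,M]$. -/

import Mathlib

open CategoryTheory CategoryTheory.Limits

universe v u

noncomputable section

namespace SemiAb

attribute [local simp] prod.lift_fst prod.lift_fst_assoc prod.lift_snd prod.lift_snd_assoc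
  prod.map_fst prod.map_fst_assoc prod.map_snd prod.map_snd_assoc
  coprod.inl_desc coprod.inl_desc_assoc coprod.inr_desc coprod.inr_desc_assoc
  pullback.lift_fst pullback.lift_fst_assoc pullback.lift_snd pullback.lift_snd_assoc
  coequalizer.π_desc coequalizer.π_desc_assoc

variable {C : Type u} [Category.{v} C]

/-- A category is Barr-exact if it is regular and every internal equivalence relation
is the kernel pair of some morphism. -/
class BarrExact (C : Type u) [Category.{v} C] : Prop extends Regular C where
  effective : ∀ {R X : C} (r₀ r₁ : R ⟶ X), IsEquivalenceRelation r₀ r₁ →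
    ∃ (Y : C) (f : X ⟶ Y), IsKernelPair f r₀ r₁

/-- The Split Short Five Lemma: a morphism between split extensions which is invertible on the
kernels and on the bases is invertible. For pointed categories with finite limits this is
(Bourn) protomodularity. -/
class Protomodular (C : Type u) [Category.{v} C] [HasZeroMorphisms C] : Prop where
  splitShortFive : ∀ {K X L K' X' L' : C}
    (k : K ⟶ X) (p : X ⟶ L) (s : L ⟶ X) (w : k ≫ p = 0) (_ : s ≫ p = 𝟙 L)
    (_ : IsLimit (KernelFork.ofι k w))
    (k' : K' ⟶ X') (p' : X' ⟶ L') (s' : L' ⟶ X') (w' : k' ≫ p' = 0) (_ : s' ≫ p' = 𝟙 L')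
    (_ : IsLimit (KernelFork.ofι k' w'))
    (a : K ⟶ K') (f : X ⟶ X') (b : L ⟶ L'),
    k ≫ f = a ≫ k' → p ≫ b = f ≫ p' → s ≫ f = b ≫ s' → IsIso a → IsIso b → IsIso f

/-- A semi-abelian category: pointed, Barr-exact, protomodular, with binary coproducts. -/
class SemiAbelian (C : Type u) [Category.{v} C] [HasZeroMorphisms C] : Prop
    extends BarrExact C, Protomodular C where
  hasZeroObject : HasZeroObject C
  hasBinaryCoproducts : HasBinaryCoproducts C

attribute [instance] SemiAbelian.hasZeroObject SemiAbelian.hasBinaryCoproducts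

/-! ### Existence of cokernels in a semi-abelian category -/

section Cokernels

variable [HasZeroMorphisms C] [SemiAbelian C]

/-- The kernel and the section of a split extension are jointly extremal-epimorphic. -/
theorem isIso_of_factors {K X L S : C} (k : K ⟶ X) (p : X ⟶ L) (s : L ⟶ X) (w : k ≫ p = 0)
    (hs : s ≫ p = 𝟙 L) (hk : IsLimit (KernelFork.ofι k w)) (m : S ⟶ X) [Mono m]
    (k' : K ⟶ S) (hk' : k' ≫ m = k) (s' : L ⟶ S) (hs' : s' ≫ m = s) : IsIso m := by
  have w' : k' ≫ (m ≫ p) = 0 := by rw [← Category.assoc, hk', w]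
  refine Protomodular.splitShortFive k' (m ≫ p) s' w' (by rw [← Category.assoc, hs', hs]) ?_
    k p s w hs hk (𝟙 K) m (𝟙 L) (by simp [hk']) (by simp) (by simp [hs'])
    inferInstance inferInstance
  have : Mono k := ⟨fun a b h => Fork.IsLimit.hom_ext hk h⟩
  have : Mono k' := mono_of_mono_fac hk'
  refine KernelFork.IsLimit.ofι' k' w' fun {A} g hg => ?_
  have hg' : (g ≫ m) ≫ p = 0 := by simpa using hg
  refine ⟨hk.lift (KernelFork.ofι (g ≫ m) hg'), ?_⟩
  rw [← cancel_mono m, Category.assoc, hk']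
  exact Fork.IsLimit.lift_ι hk

/-- The kernel and the section of a split extension are jointly epimorphic. -/
theorem hom_ext_of_split {K X L Y : C} (k : K ⟶ X) (p : X ⟶ L) (s : L ⟶ X) (w : k ≫ p = 0)
    (hs : s ≫ p = 𝟙 L) (hk : IsLimit (KernelFork.ofι k w)) (f g : X ⟶ Y)
    (h₁ : k ≫ f = k ≫ g) (h₂ : s ≫ f = s ≫ g) : f = g := by
  have := isIso_of_factors k p s w hs hk (equalizer.ι f g) (equalizer.lift k h₁) (by simp)
    (equalizer.lift s h₂) (by simp)
  rw [← cancel_epi (equalizer.ι f g), equalizer.condition]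

/-- Every internal relation is difunctional. -/
theorem difunctional {R X : C} (r₀ r₁ : R ⟶ X) [JointlyMono₂ r₀ r₁] {A : C} (a b c : A ⟶ R)
    (hab : a ≫ r₁ = b ≫ r₁) (hbc : b ≫ r₀ = c ≫ r₀) :
    ∃ t : A ⟶ R, t ≫ r₀ = a ≫ r₀ ∧ t ≫ r₁ = c ≫ r₁ := by
  have : Mono (prod.lift r₀ r₁) := ⟨fun x y h => JointlyMono₂.right_cancellation (p₁ := r₀)
    (p₂ := r₁) x y
    (by simpa using congrArg (· ≫ prod.fst) h) (by simpa using congrArg (· ≫ prod.snd) h)⟩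
  let D₀ := pullback r₁ r₁
  let x : D₀ ⟶ R := pullback.fst r₁ r₁
  let z : D₀ ⟶ R := pullback.snd r₁ r₁
  let D := pullback (z ≫ r₀) r₀
  let π : D ⟶ D₀ := pullback.fst (z ≫ r₀) r₀
  let y : D ⟶ R := pullback.snd (z ≫ r₀) r₀
  let σ : D₀ ⟶ D := pullback.lift (𝟙 D₀) z (by simp)
  let g : D ⟶ X ⨯ X := prod.lift (π ≫ x ≫ r₀) (y ≫ r₁)
  have hπ : σ ≫ π = 𝟙 _ := by simp [σ, π]
  have hy : σ ≫ y = z := by simp [σ, y]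
  have hxz : x ≫ r₁ = z ≫ r₁ := pullback.condition
  let κ := kernel.ι π
  have : IsIso (pullback.fst g (prod.lift r₀ r₁)) := by
    refine isIso_of_factors κ π σ (kernel.condition π) hπ (kernelIsKernel π) _
      (pullback.lift κ (κ ≫ y) ?_) (pullback.lift_fst _ _ _)
      (pullback.lift σ x ?_) (pullback.lift_fst _ _ _)
    · have hc : π ≫ z ≫ r₀ = y ≫ r₀ := pullback.condition
      have h0 : κ ≫ π = 0 := kernel.condition π
      ext
      · simp [g, ← hc, reassoc_of% h0]
      · simp [g]
    · ext
      · simp [g, reassoc_of% hπ]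
      · simp [g, reassoc_of% hy, hxz]
  let l : A ⟶ D := pullback.lift (pullback.lift a b hab) c (by simp [z, hbc])
  refine ⟨l ≫ inv (pullback.fst g (prod.lift r₀ r₁)) ≫ pullback.snd g (prod.lift r₀ r₁), ?_, ?_⟩
  · have := pullback.condition (f := g) (g := prod.lift r₀ r₁)
    have h := congrArg (fun q => l ≫ inv (pullback.fst g (prod.lift r₀ r₁)) ≫ q ≫ prod.fst) this
    simp only [Category.assoc, IsIso.inv_hom_id_assoc, prod.lift_fst] at h ⊢
    rw [← h]
    simp [g, l, π, x]
  · have := pullback.condition (f := g) (g := prod.lift r₀ r₁)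
    have h := congrArg (fun q => l ≫ inv (pullback.fst g (prod.lift r₀ r₁)) ≫ q ≫ prod.snd) this
    simp only [Category.assoc, IsIso.inv_hom_id_assoc, prod.lift_snd] at h ⊢
    rw [← h]
    simp [g, l, y]

/-- A semi-abelian category is Mal'tsev: reflexive relations are equivalence relations. -/
theorem isEquivalenceRelation_of_refl {R X : C} (r₀ r₁ : R ⟶ X) [JointlyMono₂ r₀ r₁]
    (e : X ⟶ R) (h₀ : e ≫ r₀ = 𝟙 X) (h₁ : e ≫ r₁ = 𝟙 X) : IsEquivalenceRelation r₀ r₁ := by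
  obtain ⟨σ, hσ₀, hσ₁⟩ := difunctional r₀ r₁ (r₁ ≫ e) (𝟙 R) (r₀ ≫ e)
    (by simp [h₁]) (by simp [h₀])
  obtain ⟨t, ht₀, ht₁⟩ := difunctional r₀ r₁ (pullback.fst r₁ r₀)
    (pullback.fst r₁ r₀ ≫ r₁ ≫ e) (pullback.snd r₁ r₀) (by simp [h₁])
    (by simp [h₀, pullback.condition])
  exact ⟨⟨{
    right_cancellation := JointlyMono₂.right_cancellation
    r := e
    reflexivity₁ := h₀
    reflexivity₂ := h₁
    s := σ
    symmetry₁ := by simpa [h₀] using hσ₀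
    symmetry₂ := by simpa [h₁] using hσ₁
    c := PullbackCone.mk _ _ pullback.condition
    isLimit := pullbackIsPullback r₁ r₀
    t := t
    transitivity₁ := ht₀
    transitivity₂ := ht₁ }⟩⟩

instance : HasCokernels C where
  has_colimit {A X} f := by
    let a : A ⨿ X ⟶ X := coprod.desc f (𝟙 X)
    let b : A ⨿ X ⟶ X := coprod.desc 0 (𝟙 X)
    let F := Regular.strongEpiMonoFactorisation (prod.lift a b)
    let r₀ : F.I ⟶ X := F.m ≫ prod.fst
    let r₁ : F.I ⟶ X := F.m ≫ prod.snd
    have ha : F.e ≫ r₀ = a := by simp [r₀]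
    have hb : F.e ≫ r₁ = b := by simp [r₁]
    have : JointlyMono₂ r₀ r₁ := ⟨fun Y x y h₁ h₂ => by
      rw [← cancel_mono F.m]
      ext
      · simpa [r₀] using h₁
      · simpa [r₁] using h₂⟩
    obtain ⟨Y, q, hq⟩ := BarrExact.effective r₀ r₁ (isEquivalenceRelation_of_refl r₀ r₁
      (coprod.inr ≫ F.e) (by simp [ha, a]) (by simp [hb, b]))
    have : HasCoequalizer r₀ r₁ := Regular.hasCoequalizer_of_isKernelPair hq
    have hf : f ≫ coequalizer.π r₀ r₁ = 0 := by
      have h := congrArg (fun t => coprod.inl ≫ F.e ≫ t) (coequalizer.condition r₀ r₁)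
      simp only [reassoc_of% ha, reassoc_of% hb] at h
      simpa [a, b] using h
    refine ⟨⟨⟨CokernelCofork.ofπ _ hf, CokernelCofork.IsColimit.ofπ' _ hf fun {Z} g hg => ?_⟩⟩⟩
    refine ⟨coequalizer.desc g ?_, coequalizer.π_desc _ _⟩
    have : Epi F.e := inferInstance
    rw [← cancel_epi F.e, reassoc_of% ha, reassoc_of% hb]
    ext
    · simp [a, b, hg]
    · simp [a, b]

end Cokernels

/-! ### Points (split epimorphisms with a chosen splitting) over a fixed base -/

/-- A point over `L`: a split epimorphism `p : X ⟶ L` with a chosen section `s`. -/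
structure Point (L : C) where
  X : C
  p : X ⟶ L
  s : L ⟶ X
  w : s ≫ p = 𝟙 L

namespace Point

attribute [simp] Point.w

@[simp]
theorem w_assoc {L Z : C} (P : Point L) (f : L ⟶ Z) : P.s ≫ P.p ≫ f = f := by
  rw [← Category.assoc, P.w, Category.id_comp]

variable {L : C}

/-- Morphisms of points over `L`. -/
@[ext]
structure Hom (P Q : Point L) where
  hom : P.X ⟶ Q.X
  w_p : hom ≫ Q.p = P.p
  w_s : P.s ≫ hom = Q.s

attribute [simp] Hom.w_p Hom.w_s

@[simp]
theorem Hom.w_p_assoc {P Q : Point L} (f : Hom P Q) {Z : C} (g : L ⟶ Z) :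
    f.hom ≫ Q.p ≫ g = P.p ≫ g := by
  rw [← Category.assoc, f.w_p]

@[simp]
theorem Hom.w_s_assoc {P Q : Point L} (f : Hom P Q) {Z : C} (g : Q.X ⟶ Z) :
    P.s ≫ f.hom ≫ g = Q.s ≫ g := by
  rw [← Category.assoc, f.w_s]

instance : Category (Point L) where
  Hom P Q := Hom P Q
  id P := { hom := 𝟙 P.X, w_p := by simp, w_s := by simp }
  comp {P Q R} f g :=
    { hom := f.hom ≫ g.hom
      w_p := by rw [Category.assoc, g.w_p, f.w_p]
      w_s := by rw [← Category.assoc, f.w_s, g.w_s] }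

@[ext]
theorem hom_ext {P Q : Point L} {f g : P ⟶ Q} (h : f.hom = g.hom) : f = g :=
  Hom.ext h

@[simp]
theorem id_hom (P : Point L) : Hom.hom (𝟙 P) = 𝟙 P.X := rfl

@[simp]
theorem comp_hom {P Q R : Point L} (f : P ⟶ Q) (g : Q ⟶ R) :
    Hom.hom (f ≫ g) = f.hom ≫ g.hom := rfl

/-- The zero morphism `P ⟶ Q` of points factors through the zero point `(1_L, 1_L)`. -/
instance : HasZeroMorphisms (Point L) where
  zero P Q := ⟨{ hom := P.p ≫ Q.s, w_p := by simp, w_s := by simp }⟩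
  comp_zero {P Q} f R := by
    apply hom_ext
    change f.hom ≫ Q.p ≫ R.s = P.p ≫ R.s
    rw [← Category.assoc, f.w_p]
  zero_comp P {Q R} f := by
    apply hom_ext
    change (P.p ≫ Q.s) ≫ f.hom = P.p ≫ R.s
    rw [Category.assoc, f.w_s]

theorem zero_hom (P Q : Point L) : (0 : P ⟶ Q).hom = P.p ≫ Q.s := rfl

section Kernel

variable [HasPullbacks C] {P Q : Point L}

/-- The kernel of a morphism `f : P ⟶ Q` of points over `L`: the point over `L` carried by the
pullback `L ×_Q P` of `f` along the section of `Q`. -/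
abbrev kernelPoint (f : P ⟶ Q) : Point L where
  X := pullback Q.s f.hom
  p := pullback.fst Q.s f.hom
  s := pullback.lift (𝟙 L) P.s (by simp)
  w := by simp

/-- The inclusion of the kernel of a morphism of points. -/
def kernelPointι (f : P ⟶ Q) : kernelPoint f ⟶ P where
  hom := pullback.snd Q.s f.hom
  w_p := by
    have h := congrArg (· ≫ Q.p) (pullback.condition (f := Q.s) (g := f.hom))
    simpa using h.symm
  w_s := by simp [kernelPoint]

instance (f : P ⟶ Q) : Mono (kernelPointι f).hom := by
  have : IsSplitMono Q.s := ⟨⟨⟨Q.p, Q.w⟩⟩⟩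
  exact inferInstanceAs (Mono (pullback.snd Q.s f.hom))

theorem kernelPoint_condition (f : P ⟶ Q) : kernelPointι f ≫ f = 0 := by
  apply hom_ext
  rw [comp_hom, zero_hom]
  exact pullback.condition.symm

/-- `kernelPointι f` is indeed a kernel of `f` in the category of points over `L`. -/
def kernelPointIsKernel (f : P ⟶ Q) :
    IsLimit (KernelFork.ofι (kernelPointι f) (kernelPoint_condition f)) :=
  have : Mono (kernelPointι f) := ⟨fun a b h => hom_ext (by
    rw [← cancel_mono (kernelPointι f).hom]
    exact congrArg Hom.hom h)⟩
  KernelFork.IsLimit.ofι' _ _ fun {A} g hg =>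
    have hg' : A.p ≫ Q.s = g.hom ≫ f.hom := (congrArg Hom.hom hg).symm
    ⟨{ hom := pullback.lift A.p g.hom hg'
       w_p := by simp [kernelPoint]
       w_s := by apply pullback.hom_ext <;> simp [kernelPoint] },
      hom_ext (by simp [kernelPointι])⟩

end Kernel

section Trivial

variable [HasZeroMorphisms C] [HasFiniteLimits C]

/-- The point `M × L ⇄ L` given by the second projection and the inclusion `⟨0, 1⟩`. -/
abbrev prodPoint (M L : C) : Point L where
  X := M ⨯ L
  p := prod.snd
  s := prod.lift 0 (𝟙 L)
  w := by simp

/-- A point `(p, s)` over `L` (equivalently, an internal `L`-action) is trivial if, with `M` the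
kernel of `p`, the split extension `M ⟶ X ⇄ L` is isomorphic to `M ⟶ M × L ⇄ L` by an
isomorphism that is the identity on `M` and on `L`. -/
def IsTrivial : ObjectProperty (Point L) := fun P =>
  ∃ φ : P ≅ prodPoint (kernel P.p) L, kernel.ι P.p ≫ φ.hom.hom = prod.lift (𝟙 _) 0

/-- The inclusion `⟨1, 0⟩` is the kernel of the second projection. -/
abbrev prodPointIsKernel (M L : C) :
    IsLimit (KernelFork.ofι (prod.lift (𝟙 M) 0) (prod.lift_snd _ _) :
      KernelFork (prod.snd : M ⨯ L ⟶ L)) :=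
  have : Mono (prod.lift (𝟙 M) (0 : M ⟶ L)) := ⟨fun a b h => by
    simpa using congrArg (· ≫ prod.fst) h⟩
  KernelFork.IsLimit.ofι' _ _ fun {A} g hg => ⟨g ≫ prod.fst, by ext <;> simp [hg]⟩

theorem isTrivial_prodPoint (M L : C) : IsTrivial (prodPoint M L) := by
  let i : kernel (prod.snd : M ⨯ L ⟶ L) ≅ M :=
    (kernelIsKernel _).conePointUniqueUpToIso (prodPointIsKernel M L)
  have hi : i.hom ≫ prod.lift (𝟙 M) 0 = kernel.ι (prod.snd : M ⨯ L ⟶ L) :=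
    (kernelIsKernel _).conePointUniqueUpToIso_hom_comp (prodPointIsKernel M L)
      WalkingParallelPair.zero
  refine ⟨{
    hom := { hom := prod.map i.inv (𝟙 L), w_p := by simp, w_s := by apply prod.hom_ext <;> simp }
    inv := { hom := prod.map i.hom (𝟙 L), w_p := by simp, w_s := by apply prod.hom_ext <;> simp }
    hom_inv_id := by apply hom_ext; simp
    inv_hom_id := by apply hom_ext; simp }, ?_⟩
  change kernel.ι (prod.snd : M ⨯ L ⟶ L) ≫ prod.map i.inv (𝟙 L) = _
  rw [← hi]
  ext <;> simp

end Trivial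

/-! ### Coinvariants -/

section Coinvariants

variable [HasZeroMorphisms C] [SemiAbelian C]

variable (L) in
/-- The full subcategory of trivial points over `L` (trivial `L`-actions). -/
abbrev TrivialPoint : Type (max u v) := (IsTrivial (L := L)).FullSubcategory

/-- The coinvariants of a point `(p, s)`: the trivial point `C_s × L ⇄ L`, where `C_s` is the
cokernel of `s`. -/
abbrev coinvariants (P : Point L) : TrivialPoint L where
  obj := prodPoint (cokernel P.s) L
  property := isTrivial_prodPoint _ _

/-- The morphism `⟨c_s, p⟩ : X ⟶ C_s × L` of points over `L`. -/
def coinvariantsUnit (P : Point L) : P ⟶ (coinvariants P).obj where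
  hom := prod.lift (cokernel.π P.s) P.p
  w_p := by simp [coinvariants]
  w_s := by apply prod.hom_ext <;> simp [coinvariants]

theorem epi_coinvariantsUnit_hom (P : Point L) : Epi (coinvariantsUnit P).hom := by
  refine ⟨fun {Z} u v h => ?_⟩
  change prod.lift (cokernel.π P.s) P.p ≫ u = prod.lift (cokernel.π P.s) P.p ≫ v at h
  have hs : P.s ≫ prod.lift (cokernel.π P.s) P.p = prod.lift 0 (𝟙 L) := by ext <;> simp
  have hk : kernel.ι P.p ≫ prod.lift (cokernel.π P.s) P.p =
      kernel.ι P.p ≫ cokernel.π P.s ≫ prod.lift (𝟙 _) 0 := by ext <;> simp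
  refine hom_ext_of_split _ _ (prod.lift 0 (𝟙 L)) (prod.lift_snd _ _) (prod.lift_snd _ _)
    (prodPointIsKernel _ L) u v ?_ ?_
  · rw [← cancel_epi (cokernel.π P.s)]
    refine hom_ext_of_split _ P.p P.s (kernel.condition _) P.w (kernelIsKernel _) _ _ ?_ ?_
    · rw [← Category.assoc (cokernel.π _), ← Category.assoc, ← hk,
        ← Category.assoc (cokernel.π _), ← Category.assoc (kernel.ι _), ← hk, Category.assoc, h,
        Category.assoc]
    · simp
  · rw [← hs, Category.assoc, h, Category.assoc]

/-- The universal property of `coinvariantsUnit P`: every morphism from `P` to a trivial point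
factors uniquely through it. -/
theorem coinvariantsUnit_bijective (P : Point L) (T : TrivialPoint L) :
    Function.Bijective (fun g : coinvariants P ⟶ T => coinvariantsUnit P ≫ g.hom) := by
  constructor
  · intro a b h
    have := epi_coinvariantsUnit_hom P
    have h' : (coinvariantsUnit P).hom ≫ a.hom.hom = (coinvariantsUnit P).hom ≫ b.hom.hom :=
      congrArg Hom.hom h
    ext
    exact (cancel_epi _).1 h'
  · intro f
    obtain ⟨φ, -⟩ := T.property
    have hs : P.s ≫ (f ≫ φ.hom).hom ≫ prod.fst = 0 := by
      rw [← Category.assoc, (f ≫ φ.hom).w_s]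
      simp
    let g : prodPoint (cokernel P.s) L ⟶ prodPoint (kernel T.obj.p) L :=
      { hom := prod.map (cokernel.desc P.s _ hs) (𝟙 L)
        w_p := by simp
        w_s := by apply prod.hom_ext <;> simp }
    refine ⟨ObjectProperty.homMk (g ≫ φ.inv), ?_⟩
    have hg : coinvariantsUnit P ≫ g = f ≫ φ.hom := by
      apply hom_ext
      ext
      · simp [coinvariantsUnit, g]
      · have h : (f ≫ φ.hom).hom ≫ prod.snd = P.p := (f ≫ φ.hom).w_p
        rw [h]
        simp [coinvariantsUnit, g]
    change coinvariantsUnit P ≫ g ≫ φ.inv = f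
    rw [← Category.assoc, hg, Category.assoc, φ.hom_inv_id, Category.comp_id]

variable (L) in
/-- The coinvariants reflector from points over `L` to trivial points over `L`. -/
def coinvariantsReflector : Point L ⥤ TrivialPoint L where
  obj P := coinvariants P
  map {P Q} f := ObjectProperty.homMk
    { hom := prod.map (cokernel.map P.s Q.s (𝟙 L) f.hom (by simp)) (𝟙 L)
      w_p := by simp [coinvariants]
      w_s := by apply prod.hom_ext <;> simp [coinvariants] }
  map_id P := by
    apply InducedCategory.hom_ext
    apply hom_ext
    apply prod.hom_ext <;> simp
  map_comp f g := by
    apply InducedCategory.hom_ext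
    apply hom_ext
    apply prod.hom_ext
    · simp only [ObjectProperty.homMk_hom, prod.map_fst, comp_hom,
        ObjectProperty.FullSubcategory.comp_hom, Category.assoc, prod.map_fst_assoc]
      congr 1
      apply coequalizer.hom_ext
      simp
    · simp

theorem coinvariantsUnit_naturality {P Q : Point L} (f : P ⟶ Q) :
    f ≫ coinvariantsUnit Q = coinvariantsUnit P ≫ ((coinvariantsReflector L).map f).hom := by
  apply hom_ext
  apply prod.hom_ext <;> simp [coinvariantsUnit, coinvariantsReflector]

variable (L) in
/-- The coinvariants reflector is left adjoint to the inclusion of trivial points. -/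
def coinvariantsAdjunction : coinvariantsReflector L ⊣ (IsTrivial (L := L)).ι :=
  Adjunction.mkOfHomEquiv
    { homEquiv := fun P T => Equiv.ofBijective _ (coinvariantsUnit_bijective P T)
      homEquiv_naturality_left_symm := by
        intro P Q T f g
        rw [Equiv.symm_apply_eq]
        have h : coinvariantsUnit Q ≫
            ((Equiv.ofBijective _ (coinvariantsUnit_bijective Q T)).symm g).hom = g :=
          (Equiv.ofBijective _ (coinvariantsUnit_bijective Q T)).apply_symm_apply g
        exact (congrArg (f ≫ ·) h).symm.trans ((Category.assoc _ _ _).symm.trans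
          ((congrArg (· ≫ _) (coinvariantsUnit_naturality f)).trans (Category.assoc _ _ _)))
      homEquiv_naturality_right := by
        intro P T T' f g
        exact (Category.assoc _ f.hom g.hom).symm }

/-- The unit of the coinvariants reflection at a point `(p, s)` is the morphism `⟨c_s, p⟩`. -/
theorem coinvariantsAdjunction_unit_app (P : Point L) :
    (coinvariantsAdjunction L).unit.app P = coinvariantsUnit P := by
  simp only [coinvariantsAdjunction, Adjunction.mkOfHomEquiv_unit_app]
  exact Category.comp_id (coinvariantsUnit P)

/-- The coinvariants commutator `⟦L, M⟧` of a point `(p, s)` over `L` with `M` the kernel of `p`: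
take the kernel of the unit of the coinvariants reflection in the category of points over `L`,
then the kernel of its underlying split epimorphism, seen as a subobject of `X`. -/
def coinvariantsCommutator (P : Point L) : Subobject P.X :=
  letI η := (coinvariantsAdjunction L).unit.app P
  Subobject.mk (kernel.ι (kernelPoint η).p ≫ (kernelPointι η).hom)

end Coinvariants

end Point

section Higgins

variable [HasZeroMorphisms C] [SemiAbelian C]

/-- The canonical morphism `K + L ⟶ K × L` with matrix `(1, 0; 0, 1)`. -/
def coprodToProd (K L : C) : K ⨿ L ⟶ K ⨯ L :=
  coprod.desc (prod.lift (𝟙 K) 0) (prod.lift 0 (𝟙 L))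

/-- The Higgins commutator `[K, L]` of a cospan `k : K ⟶ X`, `l : L ⟶ X`: the image in `X` of the
co-smash product `K ⋄ L`, the kernel of the canonical morphism `K + L ⟶ K × L`. -/
def higginsCommutator {K L X : C} (k : K ⟶ X) (l : L ⟶ X) : Subobject X :=
  imageSubobject (kernel.ι (coprodToProd K L) ≫ coprod.desc k l)

end Higgins

end SemiAb

end

/-! Both commutators are the subobject of `X` on which `p` and `c_s` vanish. For the coinvariants
commutator this is immediate from `η = ⟨c_s, p⟩` (`coinvariantsCommutator_eq_mk`). For the Higgins
commutator, write `t : L + M ⟶ X` for the map induced by `s` and `k`, and `σ : L + M ⟶ L × M` for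
the canonical one. Both `p` and `c_s` restricted along `t` factor through `σ`, so they vanish on the
image of `ker σ`.

The converse is the substance. Since `t` is a strong epimorphism, the image of `ker σ` under `t` is
normal: it is the kernel of a quotient `q : X ⟶ Y` (`exists_quotient_image_kernel`, where
Barr-exactness enters). In `Y` the images of `L` and `M` commute, which makes `Y` a product `L × ker
p'` by the Split Short Five Lemma. Hence `q` kills whatever `p` and `c_s` kill
(`comp_eq_zero_of_commute`), and such elements lie in `[L, M]`.

Finally `k ≫ c_s` is a strong epimorphism with kernel `[L, M]`, hence a cokernel of `j : [L, M] ⟶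
M`. -/

namespace SemiAb

attribute [local simp] prod.lift_fst prod.lift_fst_assoc prod.lift_snd prod.lift_snd_assoc
  prod.map_fst prod.map_fst_assoc prod.map_snd prod.map_snd_assoc
  coprod.inl_desc coprod.inl_desc_assoc coprod.inr_desc coprod.inr_desc_assoc

/-! ### Strong epimorphisms, regular pushouts and images of normal subobjects -/

section Regular

/-- A morphism factors through a monomorphism if it does so on a cover. -/
theorem exists_lift_of_cover {C : Type u} [Category.{v} C] {W Z N X : C} (c : W ⟶ Z)
    [StrongEpi c] (z : Z ⟶ X) (m : N ⟶ X)
    [Mono m] (y : W ⟶ N) (h : y ≫ m = c ≫ z) : ∃ y' : Z ⟶ N, y' ≫ m = z :=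
  have sq : CommSq y c m z := ⟨h⟩
  ⟨sq.lift, sq.fac_right⟩

variable {C : Type u} [Category.{v} C] [HasZeroMorphisms C] [SemiAbelian C]

/-- A morphism factors through a strong epimorphism as soon as it vanishes on its kernel. -/
theorem exists_desc_of_strongEpi {X Y Z : C} (f : X ⟶ Y) [StrongEpi f] (g : X ⟶ Z)
    (h : ∀ {W : C} (z : W ⟶ X), z ≫ f = 0 → z ≫ g = 0) : ∃ g' : Y ⟶ Z, f ≫ g' = g := by
  -- The first projection of the kernel pair is split by the diagonal, and its kernel consists of
  -- the pairs `(0, x)` with `x` in the kernel of `f`; it suffices to compare on these two pieces.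
  have hg : pullback.fst f f ≫ g = pullback.snd f f ≫ g := by
    refine hom_ext_of_split _ (pullback.fst f f) (pullback.lift (𝟙 X) (𝟙 X) rfl)
      (kernel.condition _) (pullback.lift_fst _ _ _) (kernelIsKernel _) _ _ ?_ ?_
    · rw [reassoc_of% (kernel.condition (pullback.fst f f)), zero_comp, ← Category.assoc]
      refine (h _ ?_).symm
      rw [Category.assoc, ← pullback.condition,
        reassoc_of% (kernel.condition (pullback.fst f f)), zero_comp]
    · rw [pullback.lift_fst_assoc, pullback.lift_snd_assoc]
  exact ⟨_, Cofork.IsColimit.π_desc' ((IsKernelPair.of_hasPullback f).toCoequalizer') g hg⟩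

/-- Heterogeneous relations are difunctional. -/
theorem difunctional_of_mono {D X Y : C} (m : D ⟶ X ⨯ Y) [Mono m] {A : C} (x x' : A ⟶ X)
    (y y' : A ⟶ Y) (a b c : A ⟶ D) (ha : a ≫ m = prod.lift x y) (hb : b ≫ m = prod.lift x' y)
    (hc : c ≫ m = prod.lift x' y') : ∃ t : A ⟶ D, t ≫ m = prod.lift x y' := by
  -- The split monomorphisms `i` and `j` turn `D` into a relation on the single object `X ⨯ Y`, to
  -- which `difunctional` applies.
  let i : X ⟶ X ⨯ Y := prod.lift (𝟙 X) 0
  let j : Y ⟶ X ⨯ Y := prod.lift 0 (𝟙 Y)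
  have hi : i ≫ prod.fst = 𝟙 X := prod.lift_fst _ _
  have hj : j ≫ prod.snd = 𝟙 Y := prod.lift_snd _ _
  have comp {B : C} (f : B ⟶ D) {u : B ⟶ X} {w : B ⟶ Y} (hf : f ≫ m = prod.lift u w) :
      f ≫ m ≫ prod.fst ≫ i = u ≫ i ∧ f ≫ m ≫ prod.snd ≫ j = w ≫ j := by
    rw [reassoc_of% hf, reassoc_of% hf, prod.lift_fst_assoc, prod.lift_snd_assoc]
    exact ⟨rfl, rfl⟩
  have : JointlyMono₂ (m ≫ prod.fst ≫ i) (m ≫ prod.snd ≫ j) := ⟨fun _ f g h₁ h₂ => by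
    rw [← cancel_mono m]
    ext
    · simpa [hi] using congrArg (· ≫ prod.fst) h₁
    · simpa [hj] using congrArg (· ≫ prod.snd) h₂⟩
  obtain ⟨t, ht₀, ht₁⟩ := difunctional (m ≫ prod.fst ≫ i) (m ≫ prod.snd ≫ j) a b c
    (by rw [(comp a ha).2, (comp b hb).2]) (by rw [(comp b hb).1, (comp c hc).1])
  refine ⟨t, ?_⟩
  rw [(comp a ha).1] at ht₀
  rw [(comp c hc).2] at ht₁
  ext
  · simpa [hi] using congrArg (· ≫ prod.fst) ht₀
  · simpa [hj] using congrArg (· ≫ prod.snd) ht₁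

/-- A morphism of split epimorphisms with strongly epic upper component is a regular pushout:
a pair of compatible elements of the codomain and of the base lifts on a cover. -/
theorem exists_lift_of_split {A B A' B' : C} (f : A ⟶ A') [StrongEpi f] (g : B ⟶ B')
    (p : A ⟶ B) (s : B ⟶ A) (hs : s ≫ p = 𝟙 B) (p' : A' ⟶ B') (s' : B' ⟶ A')
    (hp : f ≫ p' = p ≫ g) (hf : s ≫ f = g ≫ s') {Z : C} (z : Z ⟶ A') (b : Z ⟶ B)
    (hz : z ≫ p' = b ≫ g) :
    ∃ (W : C) (c : W ⟶ Z) (_ : StrongEpi c) (a : W ⟶ A), a ≫ f = c ≫ z ∧ a ≫ p = c ≫ b := by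
  let F := Regular.strongEpiMonoFactorisation (prod.lift f p)
  have hF {V : C} (x : V ⟶ A) : (x ≫ F.e) ≫ F.m = prod.lift (x ≫ f) (x ≫ p) := by
    rw [Category.assoc, F.fac, prod.comp_lift]
  let c₁ : pullback f z ⟶ Z := pullback.snd f z
  let a₁ : pullback f z ⟶ A := pullback.fst f z
  have h₁ : a₁ ≫ f = c₁ ≫ z := pullback.condition
  -- With `a₁` a local lift of `z` along `f`, the elements `a₁`, `s p a₁` and `s b` of `A` put `(z,
  -- p a₁)`, `(s' p' z, p a₁)` and `(s' p' z, b)` in the image of `⟨f, p⟩`; difunctionality yields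
  -- `(z, b)`.
  obtain ⟨t, ht⟩ := difunctional_of_mono F.m (c₁ ≫ z) (c₁ ≫ z ≫ p' ≫ s') (a₁ ≫ p) (c₁ ≫ b)
    (a₁ ≫ F.e) ((a₁ ≫ p ≫ s) ≫ F.e) ((c₁ ≫ b ≫ s) ≫ F.e)
    (by rw [hF, h₁])
    (by rw [hF]; simp only [Category.assoc, hs, hf, ← reassoc_of% hp, ← reassoc_of% h₁,
          Category.comp_id])
    (by rw [hF]; simp only [Category.assoc, hs, hf, reassoc_of% hz, Category.comp_id])
  have h₂ : pullback.fst F.e t ≫ F.e = pullback.snd F.e t ≫ t := pullback.condition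
  have h₃ := hF (pullback.fst F.e t)
  rw [h₂, Category.assoc, ht, prod.comp_lift] at h₃
  refine ⟨_, pullback.snd F.e t ≫ c₁, inferInstance, pullback.fst F.e t, ?_, ?_⟩
  · simpa using (congrArg (· ≫ prod.fst) h₃).symm
  · simpa using (congrArg (· ≫ prod.snd) h₃).symm

/-- The image of a normal subobject along a strong epimorphism is normal: given strong
epimorphisms `f : A ⟶ X` and `g : A ⟶ B`, there is a quotient `q` of `X` such that `f ≫ q` vanishes
on the kernel of `g` and every element of the kernel of `q` lifts, on a cover, to an element of the
kernel of `g`. -/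
theorem exists_quotient_image_kernel {A B X : C} (f : A ⟶ X) [StrongEpi f] (g : A ⟶ B) :
    ∃ (Y : C) (q : X ⟶ Y) (_ : StrongEpi q),
      (∀ {Z : C} (a : Z ⟶ A), a ≫ g = 0 → a ≫ f ≫ q = 0) ∧
      ∀ {Z : C} (z : Z ⟶ X), z ≫ q = 0 →
        ∃ (W : C) (c : W ⟶ Z) (_ : StrongEpi c) (a : W ⟶ A), a ≫ f = c ≫ z ∧ a ≫ g = 0 := by
  -- The direct image along `f` of the kernel pair of `g`. It is reflexive because `f` is a strong
  -- epimorphism (the filler of `sq` below), hence an effective equivalence relation.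
  let F := Regular.strongEpiMonoFactorisation
    (prod.lift (pullback.fst g g ≫ f) (pullback.snd g g ≫ f))
  let r₀ : F.I ⟶ X := F.m ≫ prod.fst
  let r₁ : F.I ⟶ X := F.m ≫ prod.snd
  have h₀ : F.e ≫ r₀ = pullback.fst g g ≫ f := by
    rw [F.fac_assoc, prod.lift_fst]
  have h₁ : F.e ≫ r₁ = pullback.snd g g ≫ f := by
    rw [F.fac_assoc, prod.lift_snd]
  let d : A ⟶ pullback g g := pullback.lift (𝟙 A) (𝟙 A) rfl
  have hd₀ : d ≫ pullback.fst g g = 𝟙 A := pullback.lift_fst _ _ _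
  have hd₁ : d ≫ pullback.snd g g = 𝟙 A := pullback.lift_snd _ _ _
  have : JointlyMono₂ r₀ r₁ := ⟨fun _ x y hx hy => by
    rw [← cancel_mono F.m]
    ext
    · simpa [r₀] using hx
    · simpa [r₁] using hy⟩
  have sq : CommSq (d ≫ F.e) f F.m (prod.lift (𝟙 X) (𝟙 X)) := ⟨by
    rw [Category.assoc, F.fac, prod.comp_lift, prod.comp_lift, reassoc_of% hd₀,
      reassoc_of% hd₁, Category.comp_id]⟩
  have hl₀ : sq.lift ≫ r₀ = 𝟙 X := by
    rw [← Category.assoc, sq.fac_right, prod.lift_fst]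
  have hl₁ : sq.lift ≫ r₁ = 𝟙 X := by
    rw [← Category.assoc, sq.fac_right, prod.lift_snd]
  obtain ⟨Y, q, hq⟩ := BarrExact.effective r₀ r₁ (isEquivalenceRelation_of_refl r₀ r₁ _ hl₀ hl₁)
  -- Effectiveness only gives some morphism with this kernel pair; its strong epic part has the same
  -- kernel.
  let Q := Regular.strongEpiMonoFactorisation q
  have hQ : Q.e ≫ Q.m = q := Q.fac
  refine ⟨Q.I, Q.e, inferInstance, fun {Z} a ha => ?_, fun {Z} z hz => ?_⟩
  · let b : Z ⟶ pullback g g := pullback.lift 0 a (by rw [ha, zero_comp])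
    have hb₀ : b ≫ pullback.fst g g = 0 := pullback.lift_fst _ _ _
    have hb₁ : b ≫ pullback.snd g g = a := pullback.lift_snd _ _ _
    rw [← cancel_mono Q.m, Category.assoc, Category.assoc, hQ, zero_comp, ← hb₁, Category.assoc,
      ← reassoc_of% h₁, ← hq.w, reassoc_of% h₀, reassoc_of% hb₀, zero_comp]
  · obtain ⟨y, hy₀, hy₁⟩ := hq.lift' 0 z (by rw [← hQ, reassoc_of% hz, zero_comp, zero_comp])
    -- The pair `(0, z)` lifts locally to the kernel pair of `g`. The regular pushout property, for
    -- first projections split by diagonals, lets the first coordinate of the lift be `0`, so that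
    -- the second lies in the kernel of `g`.
    obtain ⟨W, c, hc, a, ha, ha'⟩ := exists_lift_of_split F.e f (pullback.fst g g) d hd₀ r₀ sq.lift
      h₀ sq.fac_left.symm y (0 : Z ⟶ A) (by rw [hy₀, zero_comp])
    refine ⟨W, c, hc, a ≫ pullback.snd g g, ?_, ?_⟩
    · rw [Category.assoc, ← h₁, reassoc_of% ha, hy₁]
    · rw [Category.assoc, ← pullback.condition, reassoc_of% ha', zero_comp, comp_zero]

end Regular

/-! ### Strong epimorphisms into products -/

section Products

variable {C : Type u} [Category.{v} C] [HasZeroMorphisms C] [SemiAbelian C]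

/-- A morphism through which the kernel and the section of a split extension factor jointly
is a strong epimorphism. -/
theorem strongEpi_of_factors {K X L S : C} (k : K ⟶ X) (p : X ⟶ L) (s : L ⟶ X) (w : k ≫ p = 0)
    (hs : s ≫ p = 𝟙 L) (hk : IsLimit (KernelFork.ofι k w)) (f : S ⟶ X)
    (k' : K ⟶ S) (hk' : k' ≫ f = k) (s' : L ⟶ S) (hs' : s' ≫ f = s) : StrongEpi f := by
  let F := Regular.strongEpiMonoFactorisation f
  have : IsIso F.m := isIso_of_factors k p s w hs hk F.m (k' ≫ F.e)
    (by rw [Category.assoc, F.fac, hk']) (s' ≫ F.e) (by rw [Category.assoc, F.fac, hs'])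
  rw [← F.fac]
  infer_instance

instance strongEpi_coprodToProd (L M : C) : StrongEpi (coprodToProd L M) :=
  strongEpi_of_factors _ _ (prod.lift 0 (𝟙 M)) (prod.lift_snd _ _) (prod.lift_snd _ _)
    (Point.prodPointIsKernel L M) _ coprod.inl (coprod.inl_desc _ _) coprod.inr
    (coprod.inr_desc _ _)

/-- The base change of `e` along the second projection factors through this map, and strong
epimorphisms are pullback-stable. -/
instance strongEpi_prodMap_id {M N : C} (L : C) (e : M ⟶ N) [StrongEpi e] :
    StrongEpi (prod.map (𝟙 L) e) := by
  have h : prod.lift (pullback.fst (prod.snd : L ⨯ N ⟶ N) e ≫ prod.fst)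
      (pullback.snd prod.snd e) ≫ prod.map (𝟙 L) e = pullback.fst prod.snd e := by
    apply prod.hom_ext
    · rw [Category.assoc, prod.map_fst, prod.lift_fst_assoc, Category.comp_id]
    · rw [Category.assoc, prod.map_snd, prod.lift_snd_assoc, pullback.condition]
  have : StrongEpi (prod.lift (pullback.fst (prod.snd : L ⨯ N ⟶ N) e ≫ prod.fst)
      (pullback.snd prod.snd e) ≫ prod.map (𝟙 L) e) := by
    rw [h]
    infer_instance
  exact strongEpi_of_strongEpi (prod.lift (pullback.fst (prod.snd : L ⨯ N ⟶ N) e ≫ prod.fst)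
    (pullback.snd prod.snd e)) (prod.map (𝟙 L) e)

/-- The inclusion `⟨0, 1⟩` is the kernel of the first projection. -/
noncomputable def inrIsKernelFst (L M : C) :
    IsLimit (KernelFork.ofι (prod.lift 0 (𝟙 M)) (prod.lift_fst _ _) :
      KernelFork (prod.fst : L ⨯ M ⟶ L)) :=
  have : Mono (prod.lift (0 : M ⟶ L) (𝟙 M)) := ⟨fun a b h => by
    simpa using congrArg (· ≫ prod.snd) h⟩
  KernelFork.IsLimit.ofι' _ _ fun {A} g hg => ⟨g ≫ prod.snd, by ext <;> simp [hg]⟩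

end Products

/-! ### Commuting images, and both commutators as joint kernels of `p` and `c_s` -/

section Main

variable {C : Type u} [Category.{v} C] [HasZeroMorphisms C] [SemiAbelian C] {L M : C}

/-- If the section `s` and the kernel `k` of a split extension commute after applying a strong
epimorphism `q : X ⟶ Y` over `L`, then `Y` is a trivial point, so `q` annihilates everything that
the coinvariants unit `⟨c_s, p⟩` does. -/
theorem comp_eq_zero_of_commute (P : Point L) (k : M ⟶ P.X) (w : k ≫ P.p = 0)
    (hk : IsLimit (KernelFork.ofι k w)) {Y : C} (q : P.X ⟶ Y) [StrongEpi q] (p' : Y ⟶ L)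
    (hp' : q ≫ p' = P.p) (r : L ⨯ M ⟶ Y) (hrs : prod.lift (𝟙 L) 0 ≫ r = P.s ≫ q)
    (hrk : prod.lift 0 (𝟙 M) ≫ r = k ≫ q) {Z : C} (z : Z ⟶ P.X) (hzp : z ≫ P.p = 0)
    (hzc : z ≫ cokernel.π P.s = 0) : z ≫ q = 0 := by
  let m : kernel p' ⟶ Y := kernel.ι p'
  let e : M ⟶ kernel p' := kernel.lift p' (k ≫ q) (by rw [Category.assoc, hp', w])
  have he : e ≫ m = k ≫ q := kernel.lift_ι _ _ _
  -- Pulling `q` back along `m` gives a strong epimorphism onto `ker p'`; its domain is killed by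
  -- `p`, so it factors through `e`.
  have : StrongEpi e := by
    have hq : pullback.fst q m ≫ q = pullback.snd q m ≫ m := pullback.condition
    have hx : pullback.fst q m ≫ P.p = 0 := by
      rw [← hp', reassoc_of% hq, kernel.condition, comp_zero]
    obtain ⟨x, hx'⟩ := KernelFork.IsLimit.lift' hk _ hx
    replace hx' : x ≫ k = pullback.fst q m := hx'
    have h : x ≫ e = pullback.snd q m := by
      rw [← cancel_mono m, Category.assoc, he, reassoc_of% hx', hq]
    have : StrongEpi (x ≫ e) := by
      rw [h]
      infer_instance
    exact strongEpi_of_strongEpi x e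
  -- The kernel of `1 × e` is `0 × ker e`, which `r` kills because it restricts to `e ≫ m` on `M`.
  obtain ⟨r', hr'⟩ := exists_desc_of_strongEpi (prod.map (𝟙 L) e) r fun {W} y hy => by
    have h₁ : y ≫ prod.fst = 0 := by
      simpa using congrArg (· ≫ prod.fst) hy
    have h₂ : (y ≫ prod.snd) ≫ e = 0 := by
      simpa using congrArg (· ≫ prod.snd) hy
    have h₃ : y = (y ≫ prod.snd) ≫ prod.lift 0 (𝟙 M) := by
      ext
      · rw [Category.assoc, prod.lift_fst, comp_zero, h₁]
      · rw [Category.assoc, prod.lift_snd, Category.comp_id]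
    rw [h₃, Category.assoc, hrk, ← he, ← Category.assoc, h₂, zero_comp]
  have hs' : prod.lift (𝟙 L) 0 ≫ r' = P.s ≫ q := by
    rw [← hrs, ← hr', ← Category.assoc, prod.lift_map, Category.id_comp, zero_comp]
  have hm' : prod.lift 0 (𝟙 _) ≫ r' = m := by
    rw [← cancel_epi e, he, ← hrk, ← hr', ← Category.assoc, ← Category.assoc, prod.lift_map,
      prod.comp_lift, Category.comp_id, zero_comp, comp_zero, Category.id_comp]
  have hr'p : r' ≫ p' = prod.fst := by
    refine hom_ext_of_split _ _ _ (prod.lift_fst _ _) (prod.lift_fst (𝟙 L) 0)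
      (inrIsKernelFst L (kernel p')) _ _ ?_ ?_
    · rw [reassoc_of% hm', kernel.condition, prod.lift_fst]
    · rw [reassoc_of% hs', hp', P.w, prod.lift_fst]
  have : IsIso r' := Protomodular.splitShortFive _ prod.fst (prod.lift (𝟙 L) 0)
    (prod.lift_fst _ _) (prod.lift_fst _ _) (inrIsKernelFst L (kernel p')) m p' (P.s ≫ q)
    (kernel.condition p') (by rw [Category.assoc, hp', P.w]) (kernelIsKernel p') (𝟙 _) r' (𝟙 L)
    (by rw [hm', Category.id_comp]) (by rw [hr'p, Category.comp_id])
    (by rw [hs', Category.id_comp]) inferInstance inferInstance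
  -- This retraction of `m` kills the image of `s`, so `q ≫ ρ` factors through `c_s`.
  let ρ : Y ⟶ kernel p' := inv r' ≫ prod.snd
  have hsρ : P.s ≫ q ≫ ρ = 0 := by
    rw [← Category.assoc, ← hs', Category.assoc, IsIso.hom_inv_id_assoc, prod.lift_snd]
  have hmρ : m ≫ ρ = 𝟙 _ := by
    rw [← hm', Category.assoc, IsIso.hom_inv_id_assoc, prod.lift_snd]
  have hzq : z ≫ q ≫ ρ = 0 := by
    rw [← cokernel.π_desc P.s _ hsρ, reassoc_of% hzc, zero_comp]
  obtain ⟨y, hy⟩ : ∃ y : Z ⟶ kernel p', y ≫ m = z ≫ q :=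
    ⟨kernel.lift p' (z ≫ q) (by rw [Category.assoc, hp', hzp]), kernel.lift_ι _ _ _⟩
  have : y = 0 := by
    rw [← Category.comp_id y, ← hmρ, reassoc_of% hy, hzq]
  rw [← hy, this, zero_comp]

variable (P : Point L) (k : M ⟶ P.X)

theorem strongEpi_desc_section_kernel (w : k ≫ P.p = 0)
    (hk : IsLimit (KernelFork.ofι k w)) :
    StrongEpi (coprod.desc P.s k) :=
  strongEpi_of_factors k P.p P.s w P.w hk _ coprod.inr (coprod.inr_desc _ _) coprod.inl
    (coprod.inl_desc _ _)

/-- Together with the analogous identity for `c_s`, this shows that `p` and `c_s` vanish on the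
image of `L ⋄ M`. -/
theorem desc_section_kernel_comp_p (w : k ≫ P.p = 0) :
    coprod.desc P.s k ≫ P.p = coprodToProd L M ≫ prod.fst := by
  ext <;> simp [coprodToProd, w]

theorem desc_section_kernel_comp_π :
    coprod.desc P.s k ≫ cokernel.π P.s = coprodToProd L M ≫ prod.snd ≫ k ≫ cokernel.π P.s := by
  ext <;> simp [coprodToProd]

/-- The strong epimorphism `L + M ⟶ X ⟶ C_s` ends with this map, since `s` contributes nothing to
`C_s`. -/
theorem strongEpi_kernel_comp_π (w : k ≫ P.p = 0)
    (hk : IsLimit (KernelFork.ofι k w)) :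
    StrongEpi (k ≫ cokernel.π P.s) := by
  have := strongEpi_desc_section_kernel P k w hk
  have : StrongEpi (cokernel.π P.s) :=
    inferInstanceAs (StrongEpi (coequalizer.π P.s 0))
  have h : StrongEpi ((coprodToProd L M ≫ prod.snd) ≫ k ≫ cokernel.π P.s) := by
    rw [Category.assoc, ← desc_section_kernel_comp_π]
    infer_instance
  exact strongEpi_of_strongEpi (coprodToProd L M ≫ prod.snd) _

/-- A morphism annihilated by both `p` and `c_s` factors through the Higgins commutator. -/
theorem exists_lift_higginsCommutator (w : k ≫ P.p = 0)
    (hk : IsLimit (KernelFork.ofι k w)) {Z : C} (z : Z ⟶ P.X) (hzp : z ≫ P.p = 0)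
    (hzc : z ≫ cokernel.π P.s = 0) :
    ∃ y : Z ⟶ (higginsCommutator P.s k : C), y ≫ (higginsCommutator P.s k).arrow = z := by
  let σ := coprodToProd L M
  let t : L ⨿ M ⟶ P.X := coprod.desc P.s k
  have : StrongEpi t := strongEpi_desc_section_kernel P k w hk
  obtain ⟨Y, q, _, hσq, hq⟩ := exists_quotient_image_kernel t σ
  -- `r` witnesses that the images of `L` and `M` commute in `Y`.
  obtain ⟨r, hr⟩ := exists_desc_of_strongEpi σ (t ≫ q) fun a ha => hσq a ha
  obtain ⟨p', hp'⟩ := exists_desc_of_strongEpi q P.p fun x hx => by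
    obtain ⟨W, c, _, a, ha, ha'⟩ := hq x hx
    rw [← cancel_epi c, ← reassoc_of% ha, desc_section_kernel_comp_p P k w, reassoc_of% ha',
      zero_comp, comp_zero]
  have hzq : z ≫ q = 0 := by
    refine comp_eq_zero_of_commute P k w hk q p' hp' r ?_ ?_ z hzp hzc
    · rw [← coprod.inl_desc (prod.lift (𝟙 L) 0) (prod.lift 0 (𝟙 M)), Category.assoc]
      exact (congrArg (coprod.inl ≫ ·) hr).trans (coprod.inl_desc_assoc _ _ _)
    · rw [← coprod.inr_desc (prod.lift (𝟙 L) 0) (prod.lift 0 (𝟙 M)), Category.assoc]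
      exact (congrArg (coprod.inr ≫ ·) hr).trans (coprod.inr_desc_assoc _ _ _)
  obtain ⟨W, c, _, a, ha, ha'⟩ := hq z hzq
  unfold higginsCommutator
  refine exists_lift_of_cover c z _ (kernel.lift σ a ha' ≫ factorThruImageSubobject _) ?_
  rw [Category.assoc, imageSubobject_arrow_comp, kernel.lift_ι_assoc, ha]

theorem higginsCommutator_arrow_comp_eq_zero {Z : C} (f : P.X ⟶ Z)
    (hf : kernel.ι (coprodToProd L M) ≫ coprod.desc P.s k ≫ f = 0) :
    (higginsCommutator P.s k).arrow ≫ f = 0 := by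
  unfold higginsCommutator
  rw [← cancel_epi (factorThruImageSubobject
      (kernel.ι (coprodToProd L M) ≫ coprod.desc P.s k)), comp_zero,
    imageSubobject_arrow_comp_assoc, Category.assoc, hf]

theorem higginsCommutator_arrow_comp_p (w : k ≫ P.p = 0) :
    (higginsCommutator P.s k).arrow ≫ P.p = 0 :=
  higginsCommutator_arrow_comp_eq_zero P k _ (by
    rw [desc_section_kernel_comp_p P k w, kernel.condition_assoc, zero_comp])

theorem higginsCommutator_arrow_comp_π :
    (higginsCommutator P.s k).arrow ≫ cokernel.π P.s = 0 :=
  higginsCommutator_arrow_comp_eq_zero P k _ (by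
    rw [desc_section_kernel_comp_π, kernel.condition_assoc, zero_comp])

/-- The inclusion of the coinvariants commutator into `X` is annihilated by `p` and `c_s`, and is
universal as such. -/
theorem coinvariantsCommutator_eq_mk {N : C} (n : N ⟶ P.X) [Mono n] (hp : n ≫ P.p = 0)
    (hc : n ≫ cokernel.π P.s = 0)
    (hn : ∀ {Z : C} (z : Z ⟶ P.X), z ≫ P.p = 0 → z ≫ cokernel.π P.s = 0 →
      ∃ y : Z ⟶ N, y ≫ n = z) :
    P.coinvariantsCommutator = Subobject.mk n := by
  let η : P ⟶ (Point.coinvariants P).obj := (Point.coinvariantsAdjunction L).unit.app P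
  have hunit : η = Point.coinvariantsUnit P := Point.coinvariantsAdjunction_unit_app P
  change Subobject.mk (kernel.ι (Point.kernelPoint η).p ≫ (Point.kernelPointι η).hom) = _
  have hcond : pullback.fst (Point.coinvariants P).obj.s η.hom ≫ (Point.coinvariants P).obj.s =
      pullback.snd (Point.coinvariants P).obj.s η.hom ≫ η.hom := pullback.condition
  have hκ : kernel.ι (Point.kernelPoint η).p ≫ pullback.fst (Point.coinvariants P).obj.s η.hom = 0 :=
    kernel.condition _
  have hη : (kernel.ι (Point.kernelPoint η).p ≫ (Point.kernelPointι η).hom) ≫ η.hom = 0 := by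
    rw [Category.assoc]
    refine (congrArg (kernel.ι (Point.kernelPoint η).p ≫ ·) hcond.symm).trans ?_
    exact (Category.assoc _ _ _).symm.trans ((congrArg (· ≫ _) hκ).trans zero_comp)
  have hηc : η.hom ≫ prod.fst = cokernel.π P.s := by
    rw [hunit]
    exact prod.lift_fst _ _
  have hηp : η.hom ≫ prod.snd = P.p := by
    rw [hunit]
    exact prod.lift_snd _ _
  apply le_antisymm
  · obtain ⟨y, hy⟩ := hn (kernel.ι (Point.kernelPoint η).p ≫ (Point.kernelPointι η).hom)
      (by rw [← hηp, ← Category.assoc, hη, zero_comp])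
      (by rw [← hηc, ← Category.assoc, hη, zero_comp])
    exact Subobject.mk_le_mk_of_comm y hy
  · have hnη : n ≫ η.hom = 0 := by
      apply prod.hom_ext
      · rw [Category.assoc, hηc, hc, zero_comp]
      · rw [Category.assoc, hηp, hp, zero_comp]
    -- Elements of the commutator are the pairs in `L ×_Q X`, with `Q` the coinvariants point, whose
    -- `L`-coordinate is `0`.
    let x : N ⟶ pullback (Point.coinvariants P).obj.s η.hom :=
      pullback.lift 0 n (by rw [hnη, zero_comp])
    refine Subobject.mk_le_mk_of_comm (kernel.lift (Point.kernelPoint η).p x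
      (pullback.lift_fst _ _ _)) ?_
    rw [kernel.lift_ι_assoc]
    exact pullback.lift_snd _ _ _

end Main

end SemiAb

theorem mainTheorem7 {C : Type u} [Category.{v} C] [HasZeroMorphisms C] [SemiAb.SemiAbelian C]
    {L M : C} (P : SemiAb.Point L) (k : M ⟶ P.X) (w : k ≫ P.p = 0)
    (hk : IsLimit (KernelFork.ofι k w)) :
    P.coinvariantsCommutator = SemiAb.higginsCommutator P.s k ∧
    ∃ j : (SemiAb.higginsCommutator P.s k : C) ⟶ M,
      j ≫ k = (SemiAb.higginsCommutator P.s k).arrow ∧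
      ∃ e : cokernel P.s ≅ cokernel j,
        k ≫ cokernel.π P.s ≫ e.hom = cokernel.π j := by
  have hp := SemiAb.higginsCommutator_arrow_comp_p P k w
  have hc := SemiAb.higginsCommutator_arrow_comp_π P k
  refine ⟨?_, ?_⟩
  · rw [SemiAb.coinvariantsCommutator_eq_mk P _ hp hc
      (SemiAb.exists_lift_higginsCommutator P k w hk), Subobject.mk_arrow]
  have : Mono k := ⟨fun a b h => Fork.IsLimit.hom_ext hk h⟩
  obtain ⟨j, hj⟩ := KernelFork.IsLimit.lift' hk _ hp
  replace hj : j ≫ k = (SemiAb.higginsCommutator P.s k).arrow := hj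
  have := SemiAb.strongEpi_kernel_comp_π P k w hk
  -- If `z` is killed by `k ≫ c_s`, then `z ≫ k` is killed by both `p` and `c_s`, so `z` factors
  -- through `j`.
  obtain ⟨a, ha⟩ := SemiAb.exists_desc_of_strongEpi (k ≫ cokernel.π P.s) (cokernel.π j)
    fun z hz => by
      obtain ⟨y, hy⟩ := SemiAb.exists_lift_higginsCommutator P k w hk (z ≫ k)
        (by rw [Category.assoc, w, comp_zero]) (by rw [Category.assoc, hz])
      have hyz : y ≫ j = z := by rw [← cancel_mono k, Category.assoc, hj, hy]
      rw [← hyz, Category.assoc, cokernel.condition, comp_zero]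
  have hjc : j ≫ k ≫ cokernel.π P.s = 0 := by rw [reassoc_of% hj, hc]
  refine ⟨j, hj, ⟨a, cokernel.desc j _ hjc, ?_, ?_⟩, by simpa using ha⟩
  · rw [← cancel_epi (k ≫ cokernel.π P.s), ← Category.assoc, ha, cokernel.π_desc,
      Category.comp_id]
  · rw [← cancel_epi (cokernel.π j), cokernel.π_desc_assoc, ha, Category.comp_id]
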